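/- Let $p$ be a prime and $n\ge 1$ an integer. For $f\colon \mathbb F_p^n\to\mathbb F_p$ let $W_f(a)=\sum_{x\in\mathbb F_p^n}\zeta_p^{f(x)-\langle a,x\rangle}$ with $\zeta_p=e^{2\pi i/p}$, where $\langle\cdot,\cdot\rangle$ is the standard scalar product. For an integer $s\ge 0$, $f$ is called $s$-plateaued, with amplitude $p^{(n+s)/2}$, if $|W_f(a)|\in\{0,p^{(n+s)/2}\}$ for all $a\in\mathbb F_p^n$. It is called bent if for every $a\ne 0$ and every $c\in\mathbb F_p$ the equation $f(x+a)-f(x)=c$ has exactly $p^{n-1}$ solutions $x\in\mathbb F_p^n$. The components of $F\colon\mathbb F_p^n\to\mathbb F_p^n$ are the functions $F_b(x)=\langle b,F(x)\rangle$ with $b\in\mathbb F_p^n\setminus\{0\}$, counted by $b$. $F$ is plateaued if every component $F_b$ is $s_b$-plateaued for some $s_b$, which may depend on $b$. The linearity of $F$ is $\mathcal L(F)=\max_{a\in\mathbb F_p^n,\,b\in\mathbb F_p^n\setminus\{0\}}|W_{F_b}(a)|$. Theorem. Let $d>2$ be a divisor of $p^n-1$, and let $F\colon\mathbb F_p^n\to\mathbb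 F_p^n$ be a plateaued function which is $d$-to-$1$, i.e. one preimage set $F^{-1}(\beta)$ has size $1$ and all other nonempty preimage sets have size exactly $d$. Then $n$ is even, $d=p^t+1$ for some integer $t\ge 1$ with $t\mid n/2$, and $F$ has exactly $p^n-1-\frac{p^n-1}{p^t+1}$ bent components and exactly $\frac{p^n-1}{p^t+1}$ components which are plateaued with amplitude $p^{n/2+t}$. Consequently $\mathcal L(F)=p^{n/2+t}$. -/

import Mathlib

noncomputable section

namespace PlateauedFunction

/-- The Walsh transform `W_f(a) = ∑ x, ζ_p ^ (f x - ⟨a, x⟩)` of `f : 𝔽_p^n → 𝔽_p`.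
Here `ZMod.stdAddChar : ZMod p → ℂ` is the character `j ↦ ζ_p ^ j` with `ζ_p = exp (2 π i / p)`,
and `⬝ᵥ` is the standard scalar product. -/
def walsh {p n : ℕ} [NeZero p] (f : (Fin n → ZMod p) → ZMod p) (a : Fin n → ZMod p) : ℂ :=
  ∑ x : Fin n → ZMod p, ZMod.stdAddChar (f x - a ⬝ᵥ x)

/-- The component function `F_b(x) = ⟨b, F(x)⟩` of a vectorial function `F`. -/
def component {p n m : ℕ} (F : (Fin n → ZMod p) → (Fin m → ZMod p)) (b : Fin m → ZMod p) :
    (Fin n → ZMod p) → ZMod p :=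
  fun x => b ⬝ᵥ F x

/-- `f : 𝔽_p^n → 𝔽_p` is `t`-plateaued, i.e. plateaued with amplitude `p ^ ((n + t) / 2)`:
each value of its Walsh transform has absolute value `0` or `p ^ ((n + t) / 2)`. -/
def IsTPlateaued {p n : ℕ} [NeZero p] (t : ℕ) (f : (Fin n → ZMod p) → ZMod p) : Prop :=
  ∀ a : Fin n → ZMod p, ‖walsh f a‖ = 0 ∨ ‖walsh f a‖ = (p : ℝ) ^ (((n : ℝ) + (t : ℝ)) / 2)

/-- A vectorial function is plateaued if each component `F_b` is `t`-plateaued for some `t`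
which may depend on `b`. (The component for `b = 0` is the zero function,
which is always `n`-plateaued.) -/
def IsPlateaued {p n m : ℕ} [NeZero p] (F : (Fin n → ZMod p) → (Fin m → ZMod p)) : Prop :=
  ∀ b : Fin m → ZMod p, b ≠ 0 → ∃ t : ℕ, IsTPlateaued t (component F b)

/-- `f : 𝔽_p^n → 𝔽_p` is bent (perfect nonlinear): for every `a ≠ 0` and every `c`, the equation
`f (x + a) - f x = c` has exactly `p ^ (n - 1)` solutions `x`. (If `n = 0` there is no `a ≠ 0`, so
the subtraction never truncates.) -/
def IsBent {p n : ℕ} (f : (Fin n → ZMod p) → ZMod p) : Prop :=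
  ∀ a : Fin n → ZMod p, a ≠ 0 → ∀ c : ZMod p,
    {x : Fin n → ZMod p | f (x + a) - f x = c}.ncard = p ^ (n - 1)

/-- `F` has one preimage set of size `1`, and all other nonempty preimage sets have size `d`. -/
def IsDToOne {α β : Type*} (d : ℕ) (F : α → β) : Prop :=
  ∃ y₀ : β, (F ⁻¹' {y₀}).ncard = 1 ∧
    ∀ y : β, y ≠ y₀ → (F ⁻¹' {y}).Nonempty → (F ⁻¹' {y}).ncard = d

/-- The linearity of `F`: the maximum of `|W_F(b, a)|` over all `a` and all `b ≠ 0`. (For `m ≥ 1`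
this is the supremum of a finite nonempty set, hence a maximum.) -/
def linearity {p n m : ℕ} [NeZero p] (F : (Fin n → ZMod p) → (Fin m → ZMod p)) : ℝ :=
  sSup {r : ℝ | ∃ (a : Fin n → ZMod p) (b : Fin m → ZMod p),
    b ≠ 0 ∧ r = ‖walsh (component F b) a‖}

end PlateauedFunction

end

/-! Up to a root of unity, the Walsh value of F_b at 0 is S_b = ∑_x ζ_p^⟨b, F(x) - y₀⟩ = 1 + dτ with
τ ∈ ℤ[ζ_p], because every fibre except the one over the exceptional value y₀ has 0 or d elements.
Hence S_b ≠ 0, and plateauedness gives |S_b|² = p^(n+s).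

As p is totally ramified in ℤ[ζ_p], S_b differs from each of its Galois conjugates by a unit u. This
u is 1 modulo d and has absolute value 1 at every embedding, so d > 2 forces u = 1. Thus S_b is an
integer z_b ≡ 1 mod d, up to sign a power of p, and unchanged when b is scaled
(`exists_int_eq_charSum`).

Orthogonality gives, over b ≠ 0, ∑ z_b = 0 and ∑ z_b² = p^n (p^n - 1)(d - 1). Division by p^⌈n/2⌉
leaves integers w_b in one nonzero class mod d, with sum 0 and mean square at most d - 1, the least
possible value (`sum_sq_eq_of_sum_eq_zero`). Equality makes n even and |w_b| ∈ {1, d - 1}. The value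
d - 1 occurs, so d - 1 = p^t, and the second moment counts how often. Where |w_b| = 1, Parseval and
scaling invariance give bentness; the other components have amplitude p^(n/2+t), reached at 0. -/

open NumberField ComplexConjugate

namespace PlateauedFunction

/-! ### Rigidity of elements of ℤ[ζ_p] dividing a power of p -/

section Cyclotomic

variable {p : ℕ} [hp : Fact p.Prime] {K : Type*} [Field K] [NumberField K]
  [IsCyclotomicExtension {p} ℚ K]

/-- An element of `ℤ[ζ_p]` dividing a power of `p` is associated to all its Galois conjugates. -/
theorem associated_map_of_dvd_prime_pow {w : 𝓞 K} {m : ℕ} (hw : w ∣ (p : 𝓞 K) ^ m)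
    (σ : K ≃ₐ[ℚ] K) : Associated w (RingOfIntegers.mapRingHom (σ : K →+* K) w) := by
  have hζ := IsCyclotomicExtension.zeta_spec p ℚ K
  set ζ := IsCyclotomicExtension.zeta p ℚ K
  have hη : IsPrimitiveRoot (σ ζ) p := hζ.map_of_injective σ.injective
  have hπ := hζ.zeta_sub_one_prime'
  -- Total ramification: p is associated to (ζ - 1)^(p-1), so w is a unit times a power of the prime
  -- ζ - 1, which is itself associated to σζ - 1.
  have hdvd : w ∣ (hζ.toInteger - 1) ^ ((p - 1) * m) := by
    rw [pow_mul]
    exact hw.trans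
      ((IsCyclotomicExtension.Rat.associated_zeta_sub_one_pow_prime p hζ).symm.pow_pow.dvd)
  obtain ⟨i, -, hi⟩ := (dvd_prime_pow hπ _).1 hdvd
  have h1 := hi.map (RingOfIntegers.mapRingHom (σ : K →+* K))
  have h2 : RingOfIntegers.mapRingHom (σ : K →+* K) (hζ.toInteger - 1) = hη.toInteger - 1 := by
    rw [map_sub, map_one]
    rfl
  rw [map_pow, h2] at h1
  exact (hi.trans (IsCyclotomicExtension.Rat.associated_sub_one_of_isPrimitiveRoot
    p hζ hη).pow_pow).trans h1.symm

/-- A unit congruent to `1` modulo `d > 2`, all of whose conjugates have absolute value `1`,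
is equal to `1`. -/
theorem eq_one_of_dvd_sub_one {K : Type*} [Field K] [NumberField K] {u : 𝓞 K} {d : ℕ}
    (hd : 2 < d) (hu : (d : 𝓞 K) ∣ u - 1) (h : ∀ φ : K →+* ℂ, ‖φ u‖ = 1) : u = 1 := by
  obtain ⟨v, hv⟩ := hu
  by_contra hne
  have hv0 : v ≠ 0 := by
    rintro rfl
    exact hne (by simpa [sub_eq_zero] using hv)
  -- At this embedding |v| ≥ 1, whereas d|v| = |u - 1| ≤ 2.
  obtain ⟨φ, hφ⟩ := exists_conjugate_one_le_norm hv0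
  have h1 : (d : ℂ) * φ v = φ u - 1 := by
    have := congrArg (fun x : 𝓞 K => φ x) hv
    simpa using this.symm
  have h2 : (d : ℝ) * ‖φ v‖ ≤ 2 := by
    calc (d : ℝ) * ‖φ v‖ = ‖φ u - 1‖ := by rw [← h1]; simp
      _ ≤ ‖φ u‖ + ‖(1 : ℂ)‖ := norm_sub_le _ _
      _ = 2 := by rw [h φ]; norm_num
  have h3 : (2 : ℝ) < d := by exact_mod_cast hd
  nlinarith

/-- An element `w ≡ 1` modulo `d > 2` of `ℤ[ζ_p]` which divides a power of `p` and whose conjugates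
all have the same absolute value is a rational integer. -/
theorem exists_int_eq_of_dvd_prime_pow {w τ : 𝓞 K} {m d : ℕ} (hd : 2 < d)
    (hw : w ∣ (p : 𝓞 K) ^ m) (hτ : w = 1 + d * τ)
    (hnorm : ∀ φ φ' : K →+* ℂ, ‖φ w‖ = ‖φ' w‖) :
    ∃ z : ℤ, w = z ∧ (d : ℤ) ∣ z - 1 := by
  have hw0 : w ≠ 0 := by
    rintro rfl
    exact pow_ne_zero m (Nat.cast_ne_zero.2 hp.out.ne_zero) (zero_dvd_iff.1 hw)
  have hfix : ∀ σ : K ≃ₐ[ℚ] K, σ (w : K) = w := by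
    intro σ
    obtain ⟨u, hu⟩ := associated_map_of_dvd_prime_pow hw σ
    have hσ : (RingOfIntegers.mapRingHom (σ : K →+* K) w : K) = σ w := rfl
    have hu1 : (u : 𝓞 K) = 1 := by
      apply eq_one_of_dvd_sub_one hd
      -- w(u - 1) = σw - w = d(στ - τ), and w is prime to d.
      · have hcop : IsCoprime (d : 𝓞 K) w := ⟨-τ, 1, by rw [hτ]; ring⟩
        apply hcop.dvd_of_dvd_mul_left
        refine ⟨RingOfIntegers.mapRingHom (σ : K →+* K) τ - τ, ?_⟩
        rw [mul_sub, hu, hτ]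
        simp only [map_add, map_mul, map_one, map_natCast]
        ring
      · intro φ
        have h1 : φ w * φ (u : 𝓞 K) = φ.comp (σ : K →+* K) w := by
          rw [← map_mul, ← map_mul, hu]
          rfl
        have h2 := congrArg norm h1
        rw [norm_mul, hnorm (φ.comp (σ : K →+* K)) φ] at h2
        have h3 : ‖φ w‖ ≠ 0 := by simpa using hw0
        exact mul_left_cancel₀ h3 (by rw [h2, mul_one])
    rw [hu1, mul_one] at hu
    rw [← hσ, ← hu]
  have hgal : IsGalois ℚ K := IsCyclotomicExtension.isGalois {p} ℚ K
  obtain ⟨r, hr⟩ := (IsGalois.mem_range_algebraMap_iff_fixed (w : K)).2 hfix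
  obtain ⟨z, hz⟩ : ∃ z : ℤ, algebraMap ℤ ℚ z = r := by
    apply IsIntegrallyClosed.isIntegral_iff.1
    rw [← isIntegral_algebraMap_iff (algebraMap ℚ K).injective, hr]
    exact w.2
  have hwz : w = z := by
    apply RingOfIntegers.ext
    rw [← hr, ← hz]
    simp
  refine ⟨z, hwz, ?_⟩
  have hd0 : (d : ℚ) ≠ 0 := by positivity
  -- The rational number (z - 1)/d equals τ, hence is integral.
  obtain ⟨y, hy⟩ : ∃ y : ℤ, algebraMap ℤ ℚ y = ((z : ℚ) - 1) / d := by
    apply IsIntegrallyClosed.isIntegral_iff.1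
    rw [← isIntegral_algebraMap_iff (algebraMap ℚ K).injective]
    have h1 : (z : K) = 1 + d * (τ : K) := by
      have := congrArg (fun x : 𝓞 K => (x : K)) (hwz.symm.trans hτ)
      simpa using this
    have hd1 : (d : K) ≠ 0 := by simp; omega
    have h2 : algebraMap ℚ K (((z : ℚ) - 1) / d) = τ := by
      simp only [map_div₀, map_sub, map_intCast, map_one, map_natCast, h1]
      field_simp
      ring
    rw [h2]
    exact τ.2
  refine ⟨y, ?_⟩
  rw [eq_div_iff hd0] at hy
  have : ((z - 1 : ℤ) : ℚ) = ((d * y : ℤ) : ℚ) := by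
    push_cast
    rw [← hy]; simp [mul_comm]
  exact_mod_cast this

end Cyclotomic

/-- Auxiliary form of `exists_int_eq_charSum`, with the `p`-th cyclotomic field as a parameter. -/
theorem exists_int_eq_charSum_of_isCyclotomicExtension {p : ℕ} [hp : Fact p.Prime]
    (K : Type*) [Field K] [NumberField K] [IsCyclotomicExtension {p} ℚ K] {Y : Type*} [Fintype Y]
    (g : Y → ZMod p) (M : Y → ℤ) {d m : ℕ} (hd : 2 < d)
    (hm : ‖1 + d * ∑ y, (M y : ℂ) * ZMod.stdAddChar (g y)‖ ^ 2 = (p : ℝ) ^ m) :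
    ∃ z : ℤ, (d : ℤ) ∣ z - 1 ∧ ∀ c : ZMod p, c ≠ 0 →
      1 + d * ∑ y, (M y : ℂ) * ZMod.stdAddChar (c * g y) = z := by
  have hζ := IsCyclotomicExtension.zeta_spec p ℚ K
  set ζ := IsCyclotomicExtension.zeta p ℚ K
  have hirr : Irreducible (Polynomial.cyclotomic p ℚ) :=
    Polynomial.cyclotomic.irreducible_rat hp.out.pos
  have hpow : hζ.toInteger ^ p = 1 := hζ.toInteger_isPrimitiveRoot.pow_eq_one
  let ψ : AddChar (ZMod p) (𝓞 K) := AddChar.zmodChar p hpow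
  have hstd : ∀ c : ZMod p, c ≠ 0 → IsPrimitiveRoot (ZMod.stdAddChar c : ℂ) p := by
    intro c hc
    rw [IsPrimitiveRoot.iff_def]
    have key : ∀ l : ℕ, (ZMod.stdAddChar c : ℂ) ^ l = 1 ↔ (l : ZMod p) = 0 := by
      intro l
      rw [← AddChar.map_nsmul_eq_pow, nsmul_eq_mul, 
        ← AddChar.map_zero_eq_one (ZMod.stdAddChar : AddChar (ZMod p) ℂ),
        ZMod.injective_stdAddChar.eq_iff]
      simp [hc]
    refine ⟨(key p).2 (by simp), fun l hl => ?_⟩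
    exact (ZMod.natCast_eq_zero_iff _ _).1 ((key l).1 hl)
  -- Scaling the exponents by c is a change of embedding, which does not affect a rational integer.
  have hφ : ∀ c : ZMod p, c ≠ 0 → ∃ φ : K →+* ℂ, ∀ a, φ (ψ a) = ZMod.stdAddChar (c * a) := by
    intro c hc
    let φ := (hζ.embeddingsEquivPrimitiveRoots ℂ hirr).symm
      ⟨ZMod.stdAddChar c, (mem_primitiveRoots hp.out.pos).2 (hstd c hc)⟩
    have hφζ : φ ζ = ZMod.stdAddChar c := by
      rw [← hζ.embeddingsEquivPrimitiveRoots_apply_coe ℂ hirr]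
      simp [φ]
    refine ⟨φ, fun a => ?_⟩
    have h1 : ((ψ a : 𝓞 K) : K) = ζ ^ a.val := by
      simp only [ψ, AddChar.zmodChar_apply]
      rfl
    rw [h1]
    change φ (ζ ^ a.val) = _
    rw [map_pow, hφζ, ← AddChar.map_nsmul_eq_pow, nsmul_eq_mul, ZMod.natCast_zmod_val, mul_comm]
  let τ : 𝓞 K := ∑ y, (M y : 𝓞 K) * ψ (g y)
  let τ' : 𝓞 K := ∑ y, (M y : 𝓞 K) * ψ (-g y)
  have hcoe : ∀ φ : K →+* ℂ, ∀ f : Y → ZMod p,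
      φ ((1 + d * ∑ y, (M y : 𝓞 K) * ψ (f y) : 𝓞 K) : K) =
        1 + d * ∑ y, (M y : ℂ) * φ (ψ (f y)) := by
    intro φ f
    simp
  have hconj : ∀ φ : K →+* ℂ, φ ((1 + d * τ' : 𝓞 K) : K) =
      (starRingEnd ℂ) (φ ((1 + d * τ : 𝓞 K) : K)) := by
    intro φ
    rw [hcoe, hcoe]
    simp only [map_add, map_one, map_mul, map_natCast, map_sum, map_intCast]
    congr 3 with y
    congr 1
    let χ : AddChar (ZMod p) ℂ :=
      ((φ : K →* ℂ).comp (algebraMap (𝓞 K) K : 𝓞 K →* K)).compAddChar ψ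
    exact AddChar.map_neg_eq_conj χ (g y)
  obtain ⟨φ₁, hφ₁⟩ := hφ 1 one_ne_zero
  have hS : φ₁ ((1 + d * τ : 𝓞 K) : K) = 1 + d * ∑ y, (M y : ℂ) * ZMod.stdAddChar (g y) := by
    rw [hcoe]
    simp [hφ₁]
  -- The absolute value is given at one embedding only; written as an identity in `𝓞 K` it passes to
  -- all embeddings.
  have hmul : (1 + d * τ) * (1 + d * τ') = (p : 𝓞 K) ^ m := by
    apply RingOfIntegers.ext
    apply φ₁.injective
    have h1 : (((1 + d * τ) * (1 + d * τ') : 𝓞 K) : K) =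
        ((1 + d * τ : 𝓞 K) : K) * ((1 + d * τ' : 𝓞 K) : K) := map_mul (algebraMap (𝓞 K) K) _ _
    rw [h1, map_mul, hconj, Complex.mul_conj, Complex.normSq_eq_norm_sq, hS, hm]
    simp
  have hnorm : ∀ φ : K →+* ℂ, ‖φ ((1 + d * τ : 𝓞 K) : K)‖ ^ 2 = (p : ℝ) ^ m := by
    intro φ
    have h1 := congrArg (fun x : 𝓞 K => φ x) hmul
    simp only [map_mul] at h1
    rw [hconj, Complex.mul_conj, Complex.normSq_eq_norm_sq] at h1
    have h2 : φ (((p : 𝓞 K) ^ m : 𝓞 K) : K) = (((p : ℝ) ^ m : ℝ) : ℂ) := by simp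
    rw [h2] at h1
    exact_mod_cast h1
  obtain ⟨z, hz, hdz⟩ := exists_int_eq_of_dvd_prime_pow (p := p) (w := 1 + (d : 𝓞 K) * τ) hd
    (Dvd.intro _ hmul) rfl (fun φ φ' => by
      rw [← sq_eq_sq₀ (norm_nonneg _) (norm_nonneg _), hnorm, hnorm])
  refine ⟨z, hdz, fun c hc => ?_⟩
  obtain ⟨φ, hφc⟩ := hφ c hc
  have h1 := congrArg (fun x : 𝓞 K => φ x) hz
  simp only [τ] at h1
  rw [hcoe] at h1
  simpa [hφc] using h1

/-- Let `S_c = 1 + d * ∑ y, M y * ζ_p ^ (c * g y)` with `d > 2`. If `|S_1| ^ 2` is a power of `p`,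
then all `S_c` with `c ≠ 0` are equal to the same rational integer, which is `1` modulo `d`. -/
theorem exists_int_eq_charSum {p : ℕ} [hp : Fact p.Prime] {Y : Type*} [Fintype Y]
    (g : Y → ZMod p) (M : Y → ℤ) {d m : ℕ} (hd : 2 < d)
    (hm : ‖1 + d * ∑ y, (M y : ℂ) * ZMod.stdAddChar (g y)‖ ^ 2 = (p : ℝ) ^ m) :
    ∃ z : ℤ, (d : ℤ) ∣ z - 1 ∧ ∀ c : ZMod p, c ≠ 0 →
      1 + d * ∑ y, (M y : ℂ) * ZMod.stdAddChar (c * g y) = z := by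
  have : IsCyclotomicExtension {p} ℚ (CyclotomicField p ℚ) :=
    CyclotomicField.isCyclotomicExtension p ℚ
  have : NumberField (CyclotomicField p ℚ) := IsCyclotomicExtension.numberField {p} ℚ _
  exact exists_int_eq_charSum_of_isCyclotomicExtension (CyclotomicField p ℚ) g M hd hm

/-! ### Integers with prescribed first and second moments -/

/-- Integers with sum `0` lying in one nonzero residue class modulo `d` have mean square at least
`d - 1`, with equality only if they all belong to `{1, 1 - d}` or all belong to `{-1, d - 1}`. -/
theorem sum_sq_eq_of_sum_eq_zero {ι : Type*} {s : Finset ι} {w : ι → ℤ} {d : ℤ} (hd : 2 < d)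
    (hs : s.Nonempty) (hmod : ∀ i ∈ s, ∀ j ∈ s, d ∣ w i - w j) (hnd : ∀ i ∈ s, ¬ d ∣ w i)
    (hsum : ∑ i ∈ s, w i = 0) (hsq : ∑ i ∈ s, w i ^ 2 ≤ s.card * (d - 1)) :
    ∑ i ∈ s, w i ^ 2 = s.card * (d - 1) ∧ ∀ i ∈ s, w i ^ 2 = 1 ∨ w i ^ 2 = (d - 1) ^ 2 := by
  obtain ⟨i₀, hi₀⟩ := hs
  have hN : 0 < (s.card : ℤ) := by exact_mod_cast Finset.card_pos.2 ⟨i₀, hi₀⟩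
  obtain ⟨a, ha0, had, hda⟩ : ∃ a : ℤ, 0 < a ∧ a < d ∧ d ∣ w i₀ + a := by
    refine ⟨(-w i₀) % d, ?_, Int.emod_lt_of_pos _ (by omega), ?_⟩
    · refine lt_of_le_of_ne (Int.emod_nonneg _ (by omega)) fun h => hnd i₀ hi₀ ?_
      exact (dvd_neg).1 (Int.dvd_of_emod_eq_zero h.symm)
    · have := Int.dvd_sub_self_of_emod_eq (rfl : (-w i₀) % d = (-w i₀) % d)
      simpa [add_comm] using this
  -- With w i + a = dk the product is d²k(k - 1), and no integer lies strictly between 0 and 1.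
  have hnonneg : ∀ i ∈ s, 0 ≤ (w i + a) * (w i + a - d) := by
    intro i hi
    obtain ⟨k, hk⟩ : d ∣ w i + a := by
      have := dvd_add (hmod i hi i₀ hi₀) hda
      rwa [show w i - w i₀ + (w i₀ + a) = w i + a by ring] at this
    rw [hk, show d * k * (d * k - d) = d ^ 2 * (k * (k - 1)) by ring]
    apply mul_nonneg (sq_nonneg d)
    rcases le_or_gt k 0 with h | h
    · exact mul_nonneg_of_nonpos_of_nonpos h (by omega)
    · exact mul_nonneg h.le (by omega)
  have hexp : ∑ i ∈ s, (w i + a) * (w i + a - d) =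
      ∑ i ∈ s, w i ^ 2 - s.card * (a * (d - a)) := by
    have : ∀ i, (w i + a) * (w i + a - d) = w i ^ 2 + (2 * a - d) * w i - a * (d - a) := by
      intro i; ring
    simp only [this, Finset.sum_sub_distrib, Finset.sum_add_distrib, ← Finset.mul_sum, hsum,
      Finset.sum_const, nsmul_eq_mul, mul_zero, add_zero]
    ring
  have hge := Finset.sum_nonneg hnonneg
  -- This product is a(d - a) - (d - 1); its vanishing means a = 1 or a = d - 1.
  have hprod : 0 ≤ (a - 1) * (d - 1 - a) := mul_nonneg (by omega) (by omega)
  have hle : (s.card : ℤ) * (a * (d - a)) ≤ s.card * (d - 1) := by linarith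
  have hle' : a * (d - a) ≤ d - 1 := le_of_mul_le_mul_left hle hN
  have hprod0 : (a - 1) * (d - 1 - a) = 0 := by nlinarith
  have heq : a * (d - a) = d - 1 := by linarith
  rw [heq] at hexp
  refine ⟨by linarith, fun i hi => ?_⟩
  have h0 : ∑ i ∈ s, (w i + a) * (w i + a - d) = 0 := by linarith
  have hi0 := (Finset.sum_eq_zero_iff_of_nonneg hnonneg).1 h0 i hi
  rcases mul_eq_zero.1 hprod0 with h | h <;> rcases mul_eq_zero.1 hi0 with h' | h'
  · left
    rw [show w i = -1 by omega]; norm_num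
  · right
    rw [show w i = d - 1 by omega]
  · right
    rw [show w i = -(d - 1) by omega]; ring
  · left
    rw [show w i = 1 by omega]; norm_num

/-- If `p ^ t + 1 > 2` divides `p ^ n - 1` then `2 * t` divides `n`. -/
theorem two_mul_dvd_of_pow_add_one_dvd {p t n : ℕ} (hp : 2 ≤ p) (ht : 1 ≤ t)
    (h : p ^ t + 1 ∣ p ^ n - 1) : 2 * t ∣ n := by
  induction n using Nat.strong_induction_on with
  | _ n ih =>
    rcases Nat.eq_zero_or_pos n with rfl | hn
    · exact dvd_zero _
    have hn1 : 1 < p ^ n := Nat.one_lt_pow hn.ne' hp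
    have hlt : t < n := by
      by_contra hle
      have h1 := Nat.le_of_dvd (by omega) h
      have h2 : p ^ n ≤ p ^ t := Nat.pow_le_pow_right (by omega) (by omega)
      omega
    obtain ⟨r, rfl⟩ := Nat.exists_eq_add_of_lt hlt
    -- Since p^t ≡ -1, lowering the exponent by t flips the sign; two such steps lead from n to n -
    -- 2t.
    have hr : p ^ t + 1 ∣ p ^ (r + 1) + 1 := by
      have h1 : p ^ (t + r + 1) - 1 + (p ^ (r + 1) + 1) = (p ^ t + 1) * p ^ (r + 1) := by
        have : p ^ (t + r + 1) = p ^ t * p ^ (r + 1) := by rw [add_assoc, pow_add]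
        rw [add_mul, ← this]; omega
      exact (Nat.dvd_add_right h).1 (Dvd.intro _ h1.symm)
    have htr : t ≤ r + 1 := by
      by_contra hle
      have h1 := Nat.le_of_dvd (by omega) hr
      have h2 : p ^ (r + 1) < p ^ t := Nat.pow_lt_pow_right (by omega) (by omega)
      omega
    obtain ⟨m, hm⟩ := Nat.exists_eq_add_of_le htr
    have hmd : p ^ t + 1 ∣ p ^ m - 1 := by
      have hm1 : 1 ≤ p ^ m := Nat.one_le_pow _ _ (by omega)
      have h1 : (p ^ t + 1) * p ^ m = (p ^ (r + 1) + 1) + (p ^ m - 1) := by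
        rw [hm, pow_add, add_mul]; omega
      exact (Nat.dvd_add_right hr).1 (Dvd.intro _ h1)
    have := ih m (by omega) hmd
    rw [show t + r + 1 = 2 * t + m by omega]
    exact dvd_add dvd_rfl this

/-- The solution of the moment equations for integers `z i ≡ 1` modulo `d` which are, up to sign,
powers of `p`. -/
theorem exists_eq_pow_add_one_of_sums {p n d : ℕ} [hp : Fact p.Prime] (hn : 1 ≤ n) (hd : 2 < d)
    (hdvd : d ∣ p ^ n - 1) {ι : Type*} {s : Finset ι} {z : ι → ℤ} (hcard : s.card = p ^ n - 1)
    (hz : ∀ i ∈ s, ∃ m : ℕ, z i ^ 2 = (p : ℤ) ^ (n + m)) (hz1 : ∀ i ∈ s, (d : ℤ) ∣ z i - 1)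
    (hsum : ∑ i ∈ s, z i = 0)
    (hsq : ∑ i ∈ s, z i ^ 2 = (p : ℤ) ^ n * (((p : ℤ) ^ n - 1) * (d - 1))) :
    Even n ∧ ∃ t : ℕ, 1 ≤ t ∧ d = p ^ t + 1 ∧
      (∀ i ∈ s, z i ^ 2 = (p : ℤ) ^ n ∨ z i ^ 2 = (p : ℤ) ^ (n + 2 * t)) ∧
      (s.filter fun i => z i ^ 2 = (p : ℤ) ^ (n + 2 * t)).card * (p ^ t + 1) = p ^ n - 1 := by
  have hp2 : 2 ≤ p := hp.out.two_le
  have hp0 : (p : ℤ) ≠ 0 := by exact_mod_cast hp.out.ne_zero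
  have hpn1 : 1 < p ^ n := Nat.one_lt_pow (by omega) hp2
  have hcardZ : (s.card : ℤ) = (p : ℤ) ^ n - 1 := by
    rw [hcard, Nat.cast_sub hpn1.le]; simp
  have hs : s.Nonempty := Finset.card_pos.1 (by omega)
  have hcop : IsCoprime (d : ℤ) (p : ℤ) := by
    have h1 : (d : ℤ) ∣ (p : ℤ) ^ n - 1 := by rw [← hcardZ, hcard]; exact_mod_cast hdvd
    obtain ⟨k, hk⟩ := h1
    refine ⟨-k, (p : ℤ) ^ (n - 1), ?_⟩
    rw [← pow_succ, Nat.sub_add_cancel hn]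
    linarith
  -- h = ⌈n/2⌉: each |z i| is p^j with 2j ≥ n, hence divisible by p^h.
  set h := (n + 1) / 2
  have hval : ∀ i, i ∈ s → ∃ w : ℤ, ∃ k : ℕ, z i = (p : ℤ) ^ h * w ∧ w ^ 2 = ((p : ℤ) ^ k) ^ 2 := by
    intro i hi
    obtain ⟨m, hm⟩ := hz i hi
    have h1 : (z i).natAbs ^ 2 = p ^ (n + m) := by
      have := congrArg Int.natAbs hm
      simpa [Int.natAbs_pow] using this
    obtain ⟨k, -, hk⟩ := (Nat.dvd_prime_pow hp.out).1 (h1 ▸ Dvd.intro_left (z i).natAbs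
      (by rw [sq]) : (z i).natAbs ∣ p ^ (n + m))
    have hk2 : k * 2 = n + m := by
      rw [hk, ← pow_mul] at h1
      exact Nat.pow_right_injective hp2 h1
    obtain ⟨l, rfl⟩ := Nat.exists_eq_add_of_le (show h ≤ k by omega)
    rcases Int.natAbs_eq (z i) with h2 | h2 <;> rw [hk] at h2
    · exact ⟨(p : ℤ) ^ l, l, by rw [h2]; push_cast; rw [pow_add], rfl⟩
    · exact ⟨-(p : ℤ) ^ l, l, by rw [h2]; push_cast; rw [pow_add]; ring, by ring⟩
  choose! w k hw hwk using hval
  have hph : (p : ℤ) ^ h ≠ 0 := pow_ne_zero _ hp0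
  have hcoph : IsCoprime (d : ℤ) ((p : ℤ) ^ h) := hcop.pow_right
  have hmod : ∀ i ∈ s, ∀ j ∈ s, (d : ℤ) ∣ w i - w j := by
    intro i hi j hj
    apply hcoph.dvd_of_dvd_mul_left
    rw [mul_sub, ← hw i hi, ← hw j hj, show z i - z j = (z i - 1) - (z j - 1) by ring]
    exact dvd_sub (hz1 i hi) (hz1 j hj)
  have hnd : ∀ i ∈ s, ¬ (d : ℤ) ∣ w i := by
    intro i hi hdi
    have h1 : (d : ℤ) ∣ z i := by rw [hw i hi]; exact Dvd.dvd.mul_left hdi _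
    have h2 : (d : ℤ) ∣ 1 := by
      have := dvd_sub h1 (hz1 i hi)
      rwa [sub_sub_cancel] at this
    have := Int.le_of_dvd one_pos h2
    omega
  have hwsum : ∑ i ∈ s, w i = 0 := by
    rw [Finset.sum_congr rfl hw, ← Finset.mul_sum] at hsum
    exact (mul_eq_zero.1 hsum).resolve_left hph
  have hdZ : (2 : ℤ) < d := by exact_mod_cast hd
  have hzw : ∑ i ∈ s, z i ^ 2 = (p : ℤ) ^ (2 * h) * ∑ i ∈ s, w i ^ 2 := by
    rw [Finset.mul_sum]
    refine Finset.sum_congr rfl fun i hi => ?_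
    rw [hw i hi]; ring
  have hmean : (p : ℤ) ^ (2 * h - n) * ∑ i ∈ s, w i ^ 2 = s.card * (d - 1) := by
    apply mul_left_cancel₀ (pow_ne_zero n hp0)
    rw [← mul_assoc, ← pow_add, show n + (2 * h - n) = 2 * h by omega, ← hzw, hsq, hcardZ]
  have hNpos : 0 < (s.card : ℤ) * (d - 1) :=
    mul_pos (by exact_mod_cast Finset.card_pos.2 hs) (by omega)
  have hwnn : 0 ≤ ∑ i ∈ s, w i ^ 2 := Finset.sum_nonneg fun i _ => sq_nonneg _
  have hple : (1 : ℤ) ≤ (p : ℤ) ^ (2 * h - n) := by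
    exact_mod_cast Nat.one_le_pow _ _ hp.out.pos
  obtain ⟨hweq, hw2⟩ := sum_sq_eq_of_sum_eq_zero hdZ hs hmod hnd hwsum (by nlinarith)
  -- For odd n the mean square of w would be (d - 1)/p, below the minimum d - 1.
  have hn2 : 2 * h = n := by
    by_contra hne
    have h1 : 2 * h - n = 1 := by omega
    rw [hweq, h1, pow_one] at hmean
    have : (2 : ℤ) ≤ p := by exact_mod_cast hp2
    nlinarith
  refine ⟨⟨h, by omega⟩, ?_⟩
  obtain ⟨i, hi, hne⟩ : ∃ i ∈ s, w i ^ 2 ≠ 1 := by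
    by_contra! hall
    rw [Finset.sum_congr rfl hall] at hweq
    simp only [Finset.sum_const, nsmul_eq_mul, mul_one] at hweq
    nlinarith
  have hdk : d = p ^ k i + 1 := by
    have h1 := (hw2 i hi).resolve_left hne
    rw [hwk i hi] at h1
    have h2 := (sq_eq_sq₀ (by positivity) (by omega)).1 h1
    have h3 : (d : ℤ) = ((p ^ k i + 1 : ℕ) : ℤ) := by push_cast; omega
    exact_mod_cast h3
  have hzz : ∀ j ∈ s, z j ^ 2 = (p : ℤ) ^ n * w j ^ 2 := by
    intro j hj
    rw [hw j hj, mul_pow, ← pow_mul, mul_comm h 2, hn2]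
  set t := k i
  have hdt : (d : ℤ) - 1 = (p : ℤ) ^ t := by rw [hdk]; push_cast; ring
  have ht : 1 ≤ t := by
    by_contra h0
    rw [show t = 0 by omega, pow_zero] at hdk
    omega
  have hzcase : ∀ j ∈ s, z j ^ 2 = (p : ℤ) ^ n ∨ z j ^ 2 = (p : ℤ) ^ (n + 2 * t) := by
    intro j hj
    rcases hw2 j hj with h1 | h1
    · left; rw [hzz j hj, h1, mul_one]
    · right; rw [hzz j hj, h1, hdt]; ring
  refine ⟨t, ht, hdk, hzcase, ?_⟩
  set N := (s.filter fun i => z i ^ 2 = (p : ℤ) ^ (n + 2 * t)).card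
  have hpn0 : (p : ℤ) ^ n ≠ 0 := pow_ne_zero _ hp0
  have hpt : (1 : ℤ) < (p : ℤ) ^ t := by exact_mod_cast Nat.one_lt_pow (by omega) hp2
  have hcount : ∑ j ∈ s, z j ^ 2 =
      (p : ℤ) ^ n * (s.card + N * (((p : ℤ) ^ t) ^ 2 - 1)) := by
    have h1 : ∀ j ∈ s, z j ^ 2 = (p : ℤ) ^ n +
        if z j ^ 2 = (p : ℤ) ^ (n + 2 * t) then (p : ℤ) ^ n * (((p : ℤ) ^ t) ^ 2 - 1) else 0 := by
      intro j hj
      split_ifs with h2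
      · rw [h2]; ring
      · rw [(hzcase j hj).resolve_right h2, add_zero]
    rw [Finset.sum_congr rfl h1, Finset.sum_add_distrib, ← Finset.sum_filter]
    simp only [Finset.sum_const, nsmul_eq_mul, N]
    ring
  rw [hcount, hdt, ← hcardZ] at hsq
  have h1 := mul_left_cancel₀ hpn0 hsq
  have h2 : ((p : ℤ) ^ t - 1) * (N * ((p : ℤ) ^ t + 1)) = ((p : ℤ) ^ t - 1) * s.card := by
    linear_combination h1
  have h3 := mul_left_cancel₀ (by omega) h2
  rw [← hcard]
  exact_mod_cast h3

/-! ### Fourier analysis on 𝔽_p^n and bentness -/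

section Walsh

variable {p : ℕ} [hp : Fact p.Prime] {n : ℕ}

theorem sum_stdAddChar_mul (c : ZMod p) :
    ∑ a : ZMod p, (ZMod.stdAddChar (a * c) : ℂ) = if c = 0 then (p : ℂ) else 0 := by
  rw [AddChar.sum_mulShift c (ZMod.isPrimitive_stdAddChar p), ZMod.card]
  simp

/-- Orthogonality of the characters of `𝔽_p ^ n`. -/
theorem sum_stdAddChar_dotProduct (v : Fin n → ZMod p) :
    ∑ b : Fin n → ZMod p, (ZMod.stdAddChar (b ⬝ᵥ v) : ℂ) = if v = 0 then (p : ℂ) ^ n else 0 := by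
  have h1 : ∀ b : Fin n → ZMod p, (ZMod.stdAddChar (b ⬝ᵥ v) : ℂ) =
      ∏ i, ZMod.stdAddChar (b i * v i) := fun b => by
    have h := map_prod (ZMod.stdAddChar : AddChar (ZMod p) ℂ).toMonoidHom
      (fun i => Multiplicative.ofAdd (b i * v i)) Finset.univ
    rwa [← ofAdd_sum] at h
  simp only [h1]
  rw [← Fintype.prod_sum fun (i : Fin n) (a : ZMod p) => (ZMod.stdAddChar (a * v i) : ℂ)]
  simp only [sum_stdAddChar_mul]
  split_ifs with hv
  · simp [hv]
  · obtain ⟨i, hi⟩ := Function.ne_iff.1 hv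
    exact Finset.prod_eq_zero (Finset.mem_univ i) (if_neg hi)

/-- Parseval's identity with weights, twisted by the character given by `v`. -/
theorem sum_stdAddChar_mul_normSq {X : Type*} [Fintype X] (c : X → ℂ)
    (G : X → Fin n → ZMod p) (v : Fin n → ZMod p) :
    ∑ b : Fin n → ZMod p, (ZMod.stdAddChar (b ⬝ᵥ v) : ℂ) *
        ((‖∑ x, c x * ZMod.stdAddChar (b ⬝ᵥ G x)‖ ^ 2 : ℝ) : ℂ) =
      p ^ n * ∑ x, ∑ y, if v + G x = G y then c x * conj (c y) else 0 := by
  have h1 : ∀ b : Fin n → ZMod p, (ZMod.stdAddChar (b ⬝ᵥ v) : ℂ) *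
      ((‖∑ x, c x * ZMod.stdAddChar (b ⬝ᵥ G x)‖ ^ 2 : ℝ) : ℂ) =
      ∑ x, ∑ y, c x * conj (c y) * ZMod.stdAddChar (b ⬝ᵥ (v + G x - G y)) := by
    intro b
    rw [← Complex.normSq_eq_norm_sq, ← Complex.mul_conj, map_sum, Finset.sum_mul_sum,
      Finset.mul_sum]
    refine Finset.sum_congr rfl fun x _ => ?_
    rw [Finset.mul_sum]
    refine Finset.sum_congr rfl fun y _ => ?_
    rw [map_mul, ← AddChar.map_neg_eq_conj, dotProduct_sub, dotProduct_add, sub_eq_add_neg,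
      AddChar.map_add_eq_mul, AddChar.map_add_eq_mul]
    ring
  simp only [h1]
  rw [Finset.sum_comm, Finset.mul_sum]
  refine Finset.sum_congr rfl fun x _ => ?_
  rw [Finset.sum_comm, Finset.mul_sum]
  refine Finset.sum_congr rfl fun y _ => ?_
  rw [← Finset.mul_sum, sum_stdAddChar_dotProduct]
  simp only [sub_eq_zero]
  split_ifs <;> ring

/-- The Walsh transform inverts the autocorrelation of `f`. -/
theorem sum_stdAddChar_mul_normSq_walsh (f : (Fin n → ZMod p) → ZMod p) (v : Fin n → ZMod p) :
    ∑ a : Fin n → ZMod p, (ZMod.stdAddChar (a ⬝ᵥ v) : ℂ) * ((‖walsh f a‖ ^ 2 : ℝ) : ℂ) =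
      p ^ n * ∑ x, ZMod.stdAddChar (f (x + v) - f x) := by
  have h1 : ∀ a, walsh f a = ∑ x, ZMod.stdAddChar (f x) * ZMod.stdAddChar (a ⬝ᵥ (-x)) := by
    intro a
    refine Finset.sum_congr rfl fun x _ => ?_
    rw [sub_eq_add_neg, AddChar.map_add_eq_mul, dotProduct_neg]
  simp only [h1]
  rw [sum_stdAddChar_mul_normSq (fun x => (ZMod.stdAddChar (f x) : ℂ)) (fun x => -x) v,
    Finset.sum_comm]
  congr 1
  refine Finset.sum_congr rfl fun x _ => ?_
  rw [Finset.sum_eq_single (x + v)]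
  · rw [if_pos (by simp), ← AddChar.map_neg_eq_conj, sub_eq_add_neg, AddChar.map_add_eq_mul]
  · intro y _ hy
    rw [if_neg]
    intro h
    apply hy
    have : v - y = -x := by rw [sub_eq_add_neg]; exact h
    rw [← neg_neg x, ← this]
    abel
  · simp

theorem sum_normSq_walsh (f : (Fin n → ZMod p) → ZMod p) :
    ∑ a : Fin n → ZMod p, ‖walsh f a‖ ^ 2 = (p : ℝ) ^ n * (p : ℝ) ^ n := by
  have h := sum_stdAddChar_mul_normSq_walsh f 0
  simp only [dotProduct_zero, AddChar.map_zero_eq_one, one_mul, add_zero, sub_self,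
    Finset.sum_const, Finset.card_univ, Fintype.card_fun, ZMod.card, Fintype.card_fin,
    nsmul_eq_mul, mul_one] at h
  exact_mod_cast h

/-- The Walsh transform of a bent function has constant absolute value. -/
theorem IsBent.normSq_walsh {f : (Fin n → ZMod p) → ZMod p} (hf : IsBent f)
    (a : Fin n → ZMod p) : ‖walsh f a‖ ^ 2 = (p : ℝ) ^ n := by
  have hbal : ∀ u : Fin n → ZMod p, u ≠ 0 →
      ∑ x, (ZMod.stdAddChar (f (x + u) - f x) : ℂ) = 0 := by
    intro u hu
    have h1 := Finset.sum_fiberwise' (Finset.univ : Finset (Fin n → ZMod p))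
      (fun x => f (x + u) - f x) (fun c => (ZMod.stdAddChar c : ℂ))
    rw [← h1]
    have h2 : ∀ c : ZMod p, (Finset.univ.filter fun x => f (x + u) - f x = c).card =
        p ^ (n - 1) := by
      intro c
      rw [← hf u hu c, ← Set.ncard_coe_finset]
      simp
    simp only [Finset.sum_const, h2, ← Finset.smul_sum]
    have h3 := sum_stdAddChar_mul (1 : ZMod p)
    simp only [mul_one, one_ne_zero, if_false] at h3
    rw [h3, smul_zero]
  -- |W_f|² is the Fourier transform of the autocorrelation, of which only the term u = 0 survives.
  have h1 : ((‖walsh f a‖ ^ 2 : ℝ) : ℂ) = ∑ u : Fin n → ZMod p,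
      ZMod.stdAddChar (-(a ⬝ᵥ u)) * ∑ x, ZMod.stdAddChar (f (x + u) - f x) := by
    rw [← Complex.normSq_eq_norm_sq, ← Complex.mul_conj, walsh, map_sum, Finset.sum_mul_sum,
      Finset.sum_comm]
    simp only [Finset.mul_sum]
    conv_rhs => rw [Finset.sum_comm]
    refine Finset.sum_congr rfl fun x _ => ?_
    rw [← Equiv.sum_comp (Equiv.addLeft x)]
    refine Finset.sum_congr rfl fun u _ => ?_
    rw [← AddChar.map_neg_eq_conj, ← AddChar.map_add_eq_mul, ← AddChar.map_add_eq_mul]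
    congr 1
    simp only [Equiv.coe_addLeft, dotProduct_add]
    ring
  rw [Finset.sum_eq_single 0 (fun u _ hu => by rw [hbal u hu, mul_zero]) (by simp)] at h1
  simp only [dotProduct_zero, neg_zero, AddChar.map_zero_eq_one, one_mul, add_zero, sub_self,
    Finset.sum_const, Finset.card_univ, Fintype.card_fun, ZMod.card, Fintype.card_fin,
    nsmul_eq_mul, mul_one] at h1
  exact_mod_cast h1

/-- A function is bent if the Walsh transforms of all its nonzero multiples have constant absolute
value. -/
theorem isBent_of_normSq_walsh {f : (Fin n → ZMod p) → ZMod p}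
    (hf : ∀ c : ZMod p, c ≠ 0 → ∀ a, ‖walsh (fun x => c * f x) a‖ ^ 2 = (p : ℝ) ^ n) :
    IsBent f := by
  intro u hu k
  have hn : n ≠ 0 := by
    rintro rfl
    exact hu (Subsingleton.elim _ _)
  have hp0 : (p : ℂ) ≠ 0 := Nat.cast_ne_zero.2 hp.out.ne_zero
  have hzero : ∀ c : ZMod p, c ≠ 0 →
      ∑ x, (ZMod.stdAddChar (c * (f (x + u) - f x)) : ℂ) = 0 := by
    intro c hc
    have h1 := sum_stdAddChar_mul_normSq_walsh (fun x => c * f x) u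
    simp only [hf c hc, ← Finset.sum_mul, sum_stdAddChar_dotProduct, if_neg hu, zero_mul] at h1
    have h2 := (mul_eq_zero.1 h1.symm).resolve_left (pow_ne_zero n hp0)
    simpa only [mul_sub] using h2
  -- Summing over x first leaves only c = 0; summing over c first counts the solutions, with weight
  -- p.
  have hdouble : ∑ c : ZMod p, ∑ x, (ZMod.stdAddChar (c * (f (x + u) - f x - k)) : ℂ) =
      p ^ n := by
    rw [Finset.sum_eq_single 0]
    · simp
    · intro c _ hc
      simp only [mul_sub c _ k, sub_eq_add_neg _ (c * k), AddChar.map_add_eq_mul,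
        ← Finset.sum_mul, hzero c hc, zero_mul]
    · simp
  rw [Finset.sum_comm] at hdouble
  simp only [sum_stdAddChar_mul, sub_eq_zero (b := k)] at hdouble
  rw [← Finset.sum_filter, Finset.sum_const, nsmul_eq_mul] at hdouble
  have hcard : (Finset.univ.filter fun x => f (x + u) - f x = k).card * p = p ^ (n - 1) * p := by
    rw [← pow_succ, Nat.sub_add_cancel (Nat.one_le_iff_ne_zero.2 hn)]
    exact_mod_cast hdouble
  rw [← Nat.eq_of_mul_eq_mul_right hp.out.pos hcard, ← Set.ncard_coe_finset]
  simp

end Walsh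

/-! ### Sums over the fibres of a d-to-1 map -/

section Fibers

variable {α β : Type*} [Fintype α] [DecidableEq β] {d : ℕ} {F : α → β}

/-- The fibre sizes of a `d`-to-`1` map, in terms of the indicator function `M` of the image
without the exceptional value. -/
theorem IsDToOne.exists_card_fiber (hF : IsDToOne d F) :
    ∃ (y₀ : β) (M : β → ℤ), M y₀ = 0 ∧ (∀ y, M y ^ 2 = M y) ∧ ∀ y,
      ((Finset.univ.filter fun x => F x = y).card : ℤ) = (if y = y₀ then 1 else 0) + d * M y := by
  classical
  obtain ⟨y₀, h₀, h⟩ := hF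
  have hcard : ∀ y, (Finset.univ.filter fun x => F x = y).card = (F ⁻¹' {y}).ncard := by
    intro y
    rw [← Set.ncard_coe_finset]
    congr 1
    ext
    simp
  refine ⟨y₀, fun y => if y ≠ y₀ ∧ (F ⁻¹' {y}).Nonempty then 1 else 0, by simp, ?_, ?_⟩
  · intro y
    dsimp only
    split_ifs <;> norm_num
  · intro y
    rw [hcard]
    by_cases hy : y = y₀
    · subst hy
      simp [h₀]
    · by_cases hne : (F ⁻¹' {y}).Nonempty
      · simp [hy, hne, h y hy hne]
      · simp [hy, Set.not_nonempty_iff_eq_empty.1 hne]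

variable [Fintype β] {y₀ : β} {M : β → ℤ}

/-- Grouping by fibres. With g a character this exhibits the sum as 1 modulo d; with integer-valued
g it does the counting. -/
theorem sum_comp_eq_of_card_fiber
    (hM : ∀ y, ((Finset.univ.filter fun x => F x = y).card : ℤ) =
      (if y = y₀ then 1 else 0) + d * M y) {R : Type*} [CommRing R] (g : β → R) :
    ∑ x, g (F x) = g y₀ + d * ∑ y, (M y : R) * g y := by
  have hR : ∀ y, ((Finset.univ.filter fun x => F x = y).card : R) =
      (if y = y₀ then 1 else 0) + d * M y := by
    intro y
    have := congrArg (Int.cast : ℤ → R) (hM y)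
    push_cast at this
    exact this
  rw [← Finset.sum_fiberwise' Finset.univ F g]
  simp only [Finset.sum_const, nsmul_eq_mul, hR, add_mul, Finset.sum_add_distrib, ite_mul, one_mul,
    zero_mul, Finset.sum_ite_eq', Finset.mem_univ, if_true, Finset.mul_sum, mul_assoc]

/-- One point is alone in its fibre and every other point lies in a fibre of size d. The sum counts
the pairs with equal image, which the second moment needs. -/
theorem sum_card_fiber_eq (hM0 : M y₀ = 0) (hM1 : ∀ y, M y ^ 2 = M y)
    (hM : ∀ y, ((Finset.univ.filter fun x => F x = y).card : ℤ) =
      (if y = y₀ then 1 else 0) + d * M y) :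
    ∑ x, ((Finset.univ.filter fun x' => F x' = F x).card : ℤ) =
      1 + d * (Fintype.card α - 1) := by
  have h1 := sum_comp_eq_of_card_fiber hM (fun _ => (1 : ℤ))
  have h2 := sum_comp_eq_of_card_fiber hM
    (fun y => ((Finset.univ.filter fun x => F x = y).card : ℤ))
  simp only [Finset.sum_const, Finset.card_univ, nsmul_eq_mul, mul_one, Int.cast_id] at h1
  have h3 : ∀ y, M y * ((if y = y₀ then 1 else 0) + d * M y) = d * M y := by
    intro y
    split_ifs with hy
    · simp [hy, hM0]
    · linear_combination (d : ℤ) * hM1 y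
  rw [h2]
  simp only [hM, Int.cast_id, h3, if_true, hM0, ← Finset.mul_sum]
  linear_combination (-d : ℤ) * h1

end Fibers

/-! ### Walsh values at 0 -/

section ShiftedSum

variable {p : ℕ} [hp : Fact p.Prime] {n : ℕ} {F : (Fin n → ZMod p) → (Fin n → ZMod p)}

/-- The normalized value at `0` of the Walsh transform of a component of `F`. -/
noncomputable def shiftedSum (F : (Fin n → ZMod p) → (Fin n → ZMod p)) (y₀ b : Fin n → ZMod p) : ℂ :=
  ∑ x, ZMod.stdAddChar (b ⬝ᵥ (F x - y₀))

theorem norm_shiftedSum (y₀ b : Fin n → ZMod p) :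
    ‖shiftedSum F y₀ b‖ = ‖walsh (component F b) 0‖ := by
  have h1 : shiftedSum F y₀ b = walsh (component F b) 0 * ZMod.stdAddChar (-(b ⬝ᵥ y₀)) := by
    rw [shiftedSum, walsh, Finset.sum_mul]
    refine Finset.sum_congr rfl fun x _ => ?_
    rw [← AddChar.map_add_eq_mul, component, zero_dotProduct, sub_zero, dotProduct_sub,
      sub_eq_add_neg]
  rw [h1, norm_mul, AddChar.norm_apply, mul_one]

/-- Otherwise -1/d would be an algebraic integer. This excludes the value 0 among the two that
plateauedness allows. -/
theorem one_add_mul_charSum_ne_zero {Y : Type*} [Fintype Y] {d : ℕ} (hd : 1 < d)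
    (g : Y → ZMod p) (M : Y → ℤ) : 1 + d * ∑ y, (M y : ℂ) * ZMod.stdAddChar (g y) ≠ 0 := by
  intro h
  have hτ : IsIntegral ℤ (∑ y, (M y : ℂ) * ZMod.stdAddChar (g y)) := by
    refine IsIntegral.sum _ fun y _ => (isIntegral_algebraMap (x := M y)).mul ?_
    refine IsIntegral.of_pow hp.out.pos ?_
    rw [← AddChar.map_nsmul_eq_pow]
    simpa using isIntegral_one
  set τ := ∑ y, (M y : ℂ) * ZMod.stdAddChar (g y)
  have hd0 : (d : ℂ) ≠ 0 := by
    simp only [ne_eq, Nat.cast_eq_zero]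
    omega
  have hτ' : τ = algebraMap ℚ ℂ (-1 / d) := by
    simp only [map_div₀, map_neg, map_one, map_natCast]
    rw [eq_div_iff hd0]
    linear_combination h
  rw [hτ', isIntegral_algebraMap_iff (algebraMap ℚ ℂ).injective] at hτ
  obtain ⟨y, hy⟩ := IsIntegrallyClosed.isIntegral_iff.1 hτ
  rw [eq_div_iff (by exact_mod_cast hd0)] at hy
  rw [eq_intCast] at hy
  have h1 : y * d = -1 := by exact_mod_cast hy
  have h2 : (d : ℤ) ∣ 1 := ⟨-y, by linear_combination h1⟩
  have := Int.le_of_dvd one_pos h2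
  omega

theorem rpow_div_two_sq (p k : ℕ) : ((p : ℝ) ^ ((k : ℝ) / 2)) ^ 2 = (p : ℝ) ^ k := by
  rw [← Real.rpow_natCast, ← Real.rpow_mul (Nat.cast_nonneg p)]
  push_cast
  rw [div_mul_cancel₀ _ two_ne_zero, Real.rpow_natCast]

theorem isTPlateaued_iff {t : ℕ} {f : (Fin n → ZMod p) → ZMod p} :
    IsTPlateaued t f ↔ ∀ a, ‖walsh f a‖ ^ 2 = 0 ∨ ‖walsh f a‖ ^ 2 = (p : ℝ) ^ (n + t) := by
  refine forall_congr' fun a => or_congr (by simp) ?_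
  rw [← rpow_div_two_sq, sq_eq_sq₀ (norm_nonneg _) (by positivity)]
  push_cast
  rfl

/-- A function plateaued with amplitude `p ^ (n / 2)` has a Walsh transform of constant absolute
value. -/
theorem IsTPlateaued.normSq_walsh {f : (Fin n → ZMod p) → ZMod p} (hf : IsTPlateaued 0 f)
    (a : Fin n → ZMod p) : ‖walsh f a‖ ^ 2 = (p : ℝ) ^ n := by
  rw [isTPlateaued_iff, add_zero] at hf
  have hle : ∀ a ∈ Finset.univ, ‖walsh f a‖ ^ 2 ≤ (p : ℝ) ^ n := by
    intro a _
    rcases hf a with h | h <;> rw [h]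
    positivity
  -- By Parseval the p^n terms, each at most p^n, have the maximal total p^(2n), so none can vanish.
  refine (Finset.sum_eq_sum_iff_of_le hle).1 ?_ a (Finset.mem_univ a)
  rw [sum_normSq_walsh]
  simp

/-- First moment: orthogonality in b counts the preimages of y₀, with weight p^n. -/
theorem sum_shiftedSum (y₀ : Fin n → ZMod p) (h : (Finset.univ.filter fun x => F x = y₀).card = 1) :
    ∑ b, shiftedSum F y₀ b = (p : ℂ) ^ n := by
  simp only [shiftedSum]
  rw [Finset.sum_comm]
  simp only [sum_stdAddChar_dotProduct, sub_eq_zero]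
  rw [← Finset.sum_filter, Finset.sum_const, h, one_smul]

/-- Second moment: orthogonality counts the pairs with equal image, and the shift by y₀ cancels. -/
theorem sum_normSq_shiftedSum (y₀ : Fin n → ZMod p) :
    ∑ b, ‖shiftedSum F y₀ b‖ ^ 2 =
      (p : ℝ) ^ n * ∑ x, ((Finset.univ.filter fun x' => F x' = F x).card : ℝ) := by
  have h := sum_stdAddChar_mul_normSq (fun _ => 1) (fun x => F x - y₀) (0 : Fin n → ZMod p)
  simp only [dotProduct_zero, AddChar.map_zero_eq_one, one_mul, zero_add, map_one,
    sub_left_inj, mul_one, Finset.sum_boole] at h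
  simp only [shiftedSum]
  have h2 : ∀ x, (Finset.univ.filter fun x' => F x = F x') =
      Finset.univ.filter fun x' => F x' = F x :=
    fun x => Finset.filter_congr fun x' _ => eq_comm
  simp only [h2] at h
  exact_mod_cast h

/-- For a plateaued `d`-to-`1` function the normalized Walsh values at `0` are rational integers
congruent to `1` modulo `d`; they do not change when `b` is scaled. -/
theorem exists_int_shiftedSum {d : ℕ} (hd : 2 < d) (hF : IsPlateaued F) {y₀ : Fin n → ZMod p}
    {M : (Fin n → ZMod p) → ℤ}
    (hM : ∀ y, ((Finset.univ.filter fun x => F x = y).card : ℤ) =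
      (if y = y₀ then 1 else 0) + d * M y) {b : Fin n → ZMod p} (hb : b ≠ 0) :
    ∃ z : ℤ, (d : ℤ) ∣ z - 1 ∧ (∀ c : ZMod p, c ≠ 0 → shiftedSum F y₀ (c • b) = z) ∧
      ∃ s : ℕ, z ^ 2 = (p : ℤ) ^ (n + s) ∧ IsTPlateaued s (component F b) := by
  have hsum : ∀ c : ZMod p, shiftedSum F y₀ (c • b) =
      1 + d * ∑ y, (M y : ℂ) * ZMod.stdAddChar (c * (b ⬝ᵥ (y - y₀))) := by
    intro c
    have := sum_comp_eq_of_card_fiber hM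
      (fun y => (ZMod.stdAddChar (c * (b ⬝ᵥ (y - y₀))) : ℂ))
    simpa only [shiftedSum, smul_dotProduct, smul_eq_mul, sub_self, dotProduct_zero, mul_zero,
      AddChar.map_zero_eq_one] using this
  have h1 := hsum 1
  simp only [one_smul, one_mul] at h1
  obtain ⟨s, hs⟩ := hF b hb
  have hne : ‖shiftedSum F y₀ b‖ ^ 2 = (p : ℝ) ^ (n + s) := by
    rw [norm_shiftedSum]
    refine (isTPlateaued_iff.1 hs 0).resolve_left fun h0 => ?_
    rw [← norm_shiftedSum y₀, h1] at h0
    exact one_add_mul_charSum_ne_zero (d := d) (by omega) _ M (by simpa using h0)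
  rw [h1] at hne
  obtain ⟨z, hdz, hz⟩ := exists_int_eq_charSum (fun y => b ⬝ᵥ (y - y₀)) M hd hne
  refine ⟨z, hdz, fun c hc => by rw [hsum, hz c hc], s, ?_, hs⟩
  have h2 := hz 1 one_ne_zero
  simp only [one_mul] at h2
  rw [h2] at hne
  have h3 : ((z : ℝ)) ^ 2 = (p : ℝ) ^ (n + s) := by
    rw [← hne]
    simp
  exact_mod_cast h3

end ShiftedSum

/-! ### Classification of the components and the final count -/

/-- The components of a plateaued `d`-to-`1` function are bent or have amplitude `p ^ (n / 2 + t)`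
with `d = p ^ t + 1`, together with the number of those of the second kind. -/
theorem amplitudes_of_isDToOne {p : ℕ} [hp : Fact p.Prime] {n : ℕ} (hn : 1 ≤ n)
    {F : (Fin n → ZMod p) → (Fin n → ZMod p)} {d : ℕ} (hd : d ∣ p ^ n - 1) (hd2 : 2 < d)
    (hF : IsPlateaued F) (hFd : IsDToOne d F) :
    Even n ∧ ∃ t : ℕ, 1 ≤ t ∧ d = p ^ t + 1 ∧
      (∀ b, b ≠ 0 → IsBent (component F b) ∧ IsTPlateaued 0 (component F b) ∧
          ¬ IsTPlateaued (2 * t) (component F b) ∨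
        ¬ IsBent (component F b) ∧ IsTPlateaued (2 * t) (component F b) ∧
          ‖walsh (component F b) 0‖ = (p : ℝ) ^ (n / 2 + t)) ∧
      {b | b ≠ 0 ∧ IsTPlateaued (2 * t) (component F b)}.ncard * (p ^ t + 1) = p ^ n - 1 := by
  classical
  have hpn : 1 < p ^ n := Nat.one_lt_pow (by omega) hp.out.two_le
  have hpR : (1 : ℝ) < p := by exact_mod_cast hp.out.one_lt
  obtain ⟨y₀, M, hM0, hM1, hM⟩ := hFd.exists_card_fiber
  have hex := fun (b : Fin n → ZMod p) (hb : b ≠ 0) => exists_int_shiftedSum hd2 hF hM hb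
  choose! z hdz hzc s hzs hs using hex
  have hz : ∀ b, b ≠ 0 → shiftedSum F y₀ b = z b := fun b hb => by
    simpa using hzc b hb 1 one_ne_zero
  have hS0 : shiftedSum F y₀ 0 = (p : ℂ) ^ n := by
    simp [shiftedSum]
  set B : Finset (Fin n → ZMod p) := Finset.univ.erase 0
  have hB : ∀ b ∈ B, b ≠ 0 := fun b hb => Finset.ne_of_mem_erase hb
  have hcard : B.card = p ^ n - 1 := by
    rw [Finset.card_erase_of_mem (Finset.mem_univ _)]
    simp
  -- The term b = 0 is p^n, already the whole first moment.
  have hsum : ∑ b ∈ B, z b = 0 := by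
    have h1 := sum_shiftedSum (F := F) y₀ (by
      have := hM y₀
      rw [if_pos rfl, hM0, mul_zero, add_zero] at this
      exact_mod_cast this)
    rw [← Finset.add_sum_erase _ _ (Finset.mem_univ 0), hS0,
      Finset.sum_congr rfl fun b hb => hz b (hB b hb)] at h1
    have h2 := add_eq_left.1 h1
    exact_mod_cast h2
  have hsq : ∑ b ∈ B, z b ^ 2 = (p : ℤ) ^ n * (((p : ℤ) ^ n - 1) * (d - 1)) := by
    have h1 := sum_normSq_shiftedSum (F := F) y₀
    have h2 := sum_card_fiber_eq hM0 hM1 hM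
    have h3 : ∀ b ∈ B, ‖shiftedSum F y₀ b‖ ^ 2 = ((z b ^ 2 : ℤ) : ℝ) := by
      intro b hb
      rw [hz b (hB b hb)]
      simp
    rw [← Finset.add_sum_erase _ _ (Finset.mem_univ 0), hS0, Finset.sum_congr rfl h3] at h1
    have h4 : ((p : ℤ) ^ n) ^ 2 + ∑ b ∈ B, z b ^ 2 =
        (p : ℤ) ^ n * ∑ x, ((Finset.univ.filter fun x' => F x' = F x).card : ℤ) := by
      simp only [norm_pow, Complex.norm_natCast] at h1
      exact_mod_cast h1
    rw [h2] at h4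
    simp only [Fintype.card_fun, ZMod.card, Fintype.card_fin, Nat.cast_pow] at h4
    linear_combination h4
  obtain ⟨hn2, t, ht, hdt, hcase, hcount⟩ := exists_eq_pow_add_one_of_sums hn hd2 hd hcard
    (fun b hb => ⟨s b, hzs b (hB b hb)⟩) (fun b hb => hdz b (hB b hb)) hsum hsq
  have hnorm : ∀ b, b ≠ 0 → ‖walsh (component F b) 0‖ ^ 2 = ((z b ^ 2 : ℤ) : ℝ) := by
    intro b hb
    rw [← norm_shiftedSum y₀, hz b hb]
    simp
  have hinj := Nat.pow_right_injective hp.out.two_le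
  have hs_of : ∀ b, b ≠ 0 → ∀ m, z b ^ 2 = (p : ℤ) ^ (n + m) → s b = m := by
    intro b hb m hm
    rw [hzs b hb] at hm
    have h1 := hinj (show p ^ (n + s b) = p ^ (n + m) by exact_mod_cast hm)
    omega
  -- The nonzero Walsh value at 0 determines the amplitude.
  have hz_of : ∀ b, b ≠ 0 → ∀ m, IsTPlateaued m (component F b) → s b = m := by
    intro b hb m hm
    refine hs_of b hb m ?_
    have h1 := (isTPlateaued_iff.1 hm 0).resolve_left fun h0 => ?_
    · rw [hnorm b hb] at h1
      exact_mod_cast h1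
    · rw [hnorm b hb, hzs b hb] at h0
      simp [hp.out.ne_zero] at h0
  have hmemB : ∀ b, b ≠ 0 → b ∈ B := fun b hb => Finset.mem_erase.2 ⟨hb, Finset.mem_univ _⟩
  refine ⟨hn2, t, ht, hdt, fun b hb => ?_, ?_⟩
  · rcases hcase b (hmemB b hb) with h | h
    · left
      -- The bentness criterion used here involves all nonzero multiples of F_b; z is constant on
      -- them.
      have hs0 : ∀ c : ZMod p, c ≠ 0 → IsTPlateaued 0 (component F (c • b)) := by
        intro c hc
        have hcb : c • b ≠ 0 := smul_ne_zero hc hb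
        have hzcb : z (c • b) = z b := by
          have := (hz (c • b) hcb).symm.trans (hzc b hb c hc)
          exact_mod_cast this
        rw [← hs_of (c • b) hcb 0 (by rw [hzcb, h, add_zero])]
        exact hs _ hcb
      have h0 : IsTPlateaued 0 (component F b) := by simpa using hs0 1 one_ne_zero
      refine ⟨isBent_of_normSq_walsh fun c hc a => ?_, h0, fun h2 => ?_⟩
      · have := (hs0 c hc).normSq_walsh a
        have he : component F (c • b) = fun x => c * component F b x := by
          funext x
          simp [component, smul_dotProduct]
        rwa [he] at this
      · have h3 := hz_of b hb 0 h0
        have h4 := hz_of b hb _ h2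
        omega
    · right
      have hsb := hs_of b hb _ h
      refine ⟨fun hbent => ?_, hsb ▸ hs b hb, ?_⟩
      · have h1 := hbent.normSq_walsh 0
        rw [hnorm b hb, h] at h1
        have h2 := hinj (show p ^ (n + 2 * t) = p ^ n by exact_mod_cast h1)
        omega
      · have h1 := hnorm b hb
        rw [h] at h1
        have h2 : n + 2 * t = (n / 2 + t) * 2 := by
          have := Nat.even_iff.1 hn2
          omega
        rw [← sq_eq_sq₀ (norm_nonneg _) (by positivity), h1, h2, pow_mul]
        push_cast
        rfl
  · rw [← hcount, ← Set.ncard_coe_finset]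
    congr 2
    ext b
    simp only [Set.mem_ofPred_eq, Finset.coe_filter]
    constructor
    · rintro ⟨hb, h⟩
      exact ⟨hmemB b hb, by rw [hzs b hb, hz_of b hb _ h]⟩
    · rintro ⟨hb, h⟩
      exact ⟨hB b hb, hs_of b (hB b hb) _ h ▸ hs b (hB b hb)⟩

/-- The linearity of a function all of whose components have at most the amplitude
`p ^ (n / 2 + t)`, which is attained at `0`. -/
theorem linearity_eq_of_forall_le {p n : ℕ} [NeZero p]
    {F : (Fin n → ZMod p) → (Fin n → ZMod p)} {r : ℝ}
    (hle : ∀ b, b ≠ 0 → ∀ a, ‖walsh (component F b) a‖ ≤ r)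
    (hex : ∃ b, b ≠ 0 ∧ ‖walsh (component F b) 0‖ = r) : linearity F = r := by
  apply IsGreatest.csSup_eq
  obtain ⟨b, hb, h⟩ := hex
  refine ⟨⟨0, b, hb, h.symm⟩, ?_⟩
  rintro _ ⟨a, b, hb, rfl⟩
  exact hle b hb a

end PlateauedFunction

theorem mainTheorem1 (p : ℕ) [Fact p.Prime] (n : ℕ) (hn : 1 ≤ n)
    (F : (Fin n → ZMod p) → (Fin n → ZMod p)) (d : ℕ)
    (hd : d ∣ p ^ n - 1) (hd2 : 2 < d)
    (hF : PlateauedFunction.IsPlateaued F) (hFd : PlateauedFunction.IsDToOne d F) :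
    Even n ∧ ∃ t : ℕ, 1 ≤ t ∧ t ∣ n / 2 ∧ d = p ^ t + 1 ∧
      (({b : Fin n → ZMod p | b ≠ 0 ∧
          PlateauedFunction.IsBent (PlateauedFunction.component F b)}.ncard : ℕ) : ℚ) =
        (p : ℚ) ^ n - 1 - ((p : ℚ) ^ n - 1) / ((p : ℚ) ^ t + 1) ∧
      (({b : Fin n → ZMod p | b ≠ 0 ∧
          PlateauedFunction.IsTPlateaued (2 * t) (PlateauedFunction.component F b)}.ncard : ℕ) : ℚ) =
        ((p : ℚ) ^ n - 1) / ((p : ℚ) ^ t + 1) ∧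
      PlateauedFunction.linearity F = (p : ℝ) ^ (n / 2 + t) := by
  have hp : p.Prime := Fact.out
  obtain ⟨hn2, t, ht, hdt, hcase, hcount⟩ :=
    PlateauedFunction.amplitudes_of_isDToOne hn hd hd2 hF hFd
  have hpn : 1 < p ^ n := Nat.one_lt_pow (by omega) hp.two_le
  obtain ⟨k, rfl⟩ := hn2.two_dvd
  have hdvd : t ∣ k := Nat.dvd_of_mul_dvd_mul_left two_pos
    (PlateauedFunction.two_mul_dvd_of_pow_add_one_dvd hp.two_le ht (hdt ▸ hd))
  have hcountQ : (({b : Fin (2 * k) → ZMod p | b ≠ 0 ∧ PlateauedFunction.IsTPlateaued (2 * t)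
      (PlateauedFunction.component F b)}.ncard : ℕ) : ℚ) =
        ((p : ℚ) ^ (2 * k) - 1) / ((p : ℚ) ^ t + 1) := by
    rw [eq_div_iff (by positivity)]
    have := congrArg (Nat.cast : ℕ → ℚ) hcount
    rw [Nat.cast_sub hpn.le] at this
    push_cast at this
    exact this
  refine ⟨hn2, t, ht, by simpa using hdvd, hdt, ?_, hcountQ, ?_⟩
  · have hunion : {b : Fin (2 * k) → ZMod p | b ≠ 0 ∧
          PlateauedFunction.IsBent (PlateauedFunction.component F b)} =
        {b | b ≠ 0} \ {b | b ≠ 0 ∧ PlateauedFunction.IsTPlateaued (2 * t)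
          (PlateauedFunction.component F b)} := by
      ext b
      simp only [Set.mem_ofPred_eq, Set.mem_sdiff]
      refine ⟨fun ⟨hb, h⟩ => ⟨hb, fun h' => ?_⟩, fun ⟨hb, h⟩ => ⟨hb, ?_⟩⟩
      · rcases hcase b hb with h1 | h1
        exacts [h1.2.2 h'.2, h1.1 h]
      · rcases hcase b hb with h1 | h1
        exacts [h1.1, absurd ⟨hb, h1.2.1⟩ h]
    have hne : {b : Fin (2 * k) → ZMod p | b ≠ 0}.ncard = p ^ (2 * k) - 1 := by
      have h1 : {b : Fin (2 * k) → ZMod p | b ≠ 0} = {0}ᶜ := by ext; simp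
      rw [h1, Set.ncard_compl, Set.ncard_singleton]
      simp
    have hadd := Set.ncard_sdiff_add_ncard_of_subset (t := {b : Fin (2 * k) → ZMod p | b ≠ 0})
      (s := {b | b ≠ 0 ∧ PlateauedFunction.IsTPlateaued (2 * t)
        (PlateauedFunction.component F b)}) (fun b hb => hb.1)
    rw [← hunion, hne] at hadd
    have h2 := congrArg (Nat.cast : ℕ → ℚ) hadd
    rw [Nat.cast_sub hpn.le] at h2
    push_cast at h2
    rw [← hcountQ]
    linarith
  · apply PlateauedFunction.linearity_eq_of_forall_le
    · intro b hb a
      have hp1 : (1 : ℝ) ≤ p := by exact_mod_cast hp.one_lt.le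
      have key : ∀ m : ℕ, m ≤ 2 * t →
          PlateauedFunction.IsTPlateaued m (PlateauedFunction.component F b) →
          ‖PlateauedFunction.walsh (PlateauedFunction.component F b) a‖ ≤
            (p : ℝ) ^ (2 * k / 2 + t) := by
        intro m hm h
        rw [← sq_le_sq₀ (norm_nonneg _) (by positivity), ← pow_mul]
        rcases PlateauedFunction.isTPlateaued_iff.1 h a with h0 | h0 <;> rw [h0]
        · positivity
        · exact pow_le_pow_right₀ hp1 (by omega)
      rcases hcase b hb with h | h
      exacts [key 0 (by omega) h.2.1, key _ le_rfl h.2.1]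
    · obtain ⟨b, hb⟩ : {b : Fin (2 * k) → ZMod p | b ≠ 0 ∧ PlateauedFunction.IsTPlateaued (2 * t)
          (PlateauedFunction.component F b)}.Nonempty := by
        rw [← Set.ncard_pos]
        refine Nat.pos_of_ne_zero fun h0 => ?_
        rw [h0, zero_mul] at hcount
        omega
      rcases hcase b hb.1 with h | h
      exacts [absurd hb.2 h.2.2, ⟨b, hb.1, h.2.2⟩]
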